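/- Let $\mathbb F_q$ be a finite field with $q$ elements, let $W$ be an $\mathbb F_q$-vector space of dimension $n\ge 2$ with a fixed basis, and let $nW$ be the direct sum of $n$ copies of $W$, on which $\mathrm{GL}(W)$ acts diagonally. Write $\mathbb F_q[nW]=\mathbb F_q[x_{ij}\mid 1\le i,j\le n]$, where $x_{ij}$ is the $j$-th coordinate function on the $i$-th copy of $W$, and let $\mathrm{GL}(W)$ act on it by $(\sigma f)(w_1,\dots,w_n)=f(\sigma^{-1}w_1,\dots,\sigma^{-1}w_n)$ (that is, by the corresponding linear substitution of the variables). Let $\mathbb F_q(nW)$ be its field of fractions. For $k\ge 0$ put $X_i^{q^k}={}^t(x_{i1}^{q^k},\dots,x_{in}^{q^k})$ and $X_i=X_i^{q^0}$, and define $$\ell_0=\det(X_1,\dots,X_n),\qquad \ell_{ij}=\det(X_1,\dots,X_{j-1},X_i^{q},X_{j+1},\dots,X_n),\qquad d_{nn}^{(i)}=\det(X_i,X_i^{q},\dots,X_i^{q^{n-1}}).$$ Let $r$ be the least positive integer with $r(q-1)-n>0$, and set $$\ell=\ell_0^{\,r(q-1)-n}\prod_{i=1}^n d_{nn}^{(i)}.$$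 Then the $n^2$ elements $\ell_{ij}/\ell_0$ are algebraically independent over $\mathbb F_q$, so that $\mathbb F_q[\ell_{ij}/\ell_0\mid 1\le i,j\le n]$ is a polynomial ring; $\ell$ is a nonzero element of both $\mathbb F_q[nW]^{\mathrm{GL}(W)}$ and $\mathbb F_q[\ell_{ij}/\ell_0\mid 1\le i,j\le n]$; and, inside $\mathbb F_q(nW)$, $$\mathbb F_q[nW]^{\mathrm{GL}(W)}[\ell^{-1}]=\mathbb F_q[\ell_{ij}/\ell_0\mid 1\le i,j\le n][\ell^{-1}].$$ -/

import Mathlib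

open MvPolynomial

noncomputable section

/-- The polynomial ring `F[mW]` of `m` copies of an `n`-dimensional space `W`, in the coordinate
functions `x_{ij} = X (i, j)`: the `j`-th coordinate (in a fixed basis of `W`) on the `i`-th copy. -/
abbrev VecPoly (F : Type*) [Field F] (m n : ℕ) : Type _ := MvPolynomial (Fin m × Fin n) F

/-- The field `F(mW)` of rational functions on `m` copies of `W`. -/
abbrev VecField (F : Type*) [Field F] (m n : ℕ) : Type _ := FractionRing (VecPoly F m n)

section Action

variable {F : Type*} [Field F] {n : ℕ} {W : Type*} [AddCommGroup W] [Module F W]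

/-- The diagonal action of `GL(W)` on `F[mW]`, i.e.
`(σ f)(w_1, …, w_m) = f (σ⁻¹ w_1, …, σ⁻¹ w_m)`, written in the coordinates of the basis `b`. -/
def glAct (b : Module.Basis (Fin n) F W) (m : ℕ) (σ : LinearMap.GeneralLinearGroup F W) :
    VecPoly F m n →ₐ[F] VecPoly F m n :=
  aeval fun p : Fin m × Fin n =>
    ∑ k : Fin n, C (LinearMap.toMatrix b b ((σ⁻¹ : LinearMap.GeneralLinearGroup F W) : W →ₗ[F] W)
      p.2 k) * X (p.1, k)

/-- The action just defined is the one on functions: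
`(σ f)(w_1, …, w_m) = f (σ⁻¹ w_1, …, σ⁻¹ w_m)`. -/
theorem eval_glAct (b : Module.Basis (Fin n) F W) (m : ℕ)
    (σ : LinearMap.GeneralLinearGroup F W) (f : VecPoly F m n) (w : Fin m → W) :
    eval (fun p : Fin m × Fin n => b.repr (w p.1) p.2) (glAct b m σ f) =
      eval (fun p : Fin m × Fin n => b.repr
        (((σ⁻¹ : LinearMap.GeneralLinearGroup F W) : W →ₗ[F] W) (w p.1)) p.2) f := by
  induction f using MvPolynomial.induction_on with
  | C a => simp [glAct]
  | add f g hf hg => simp [hf, hg]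
  | mul_X f p hf =>
    rw [map_mul, map_mul, map_mul, hf]
    congr 1
    have h := congrFun (LinearMap.toMatrix_mulVec_repr b b
      ((σ⁻¹ : LinearMap.GeneralLinearGroup F W) : W →ₗ[F] W) (w p.1)) p.2
    rw [eval_X, ← h]
    simp [glAct, Matrix.mulVec, dotProduct]

/-- The vector invariant ring `F[mW]^{GL(W)}`, as a subalgebra of `F[mW]`. -/
def glInvariants (b : Module.Basis (Fin n) F W) (m : ℕ) : Subalgebra F (VecPoly F m n) :=
  ⨅ σ : LinearMap.GeneralLinearGroup F W, AlgHom.equalizer (glAct b m σ) (AlgHom.id F _)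

theorem mem_glInvariants (b : Module.Basis (Fin n) F W) (m : ℕ) (f : VecPoly F m n) :
    f ∈ glInvariants b m ↔ ∀ σ : LinearMap.GeneralLinearGroup F W, glAct b m σ f = f := by
  simp [glInvariants, Algebra.mem_iInf, AlgHom.mem_equalizer]

end Action

section Steinberg

variable (F : Type*) [Field F] (n : ℕ)

/-- The matrix `L_0 = (X_1, …, X_n)` whose `i`-th column is `X_i = (x_{i1}, …, x_{in})ᵗ`. -/
def matL0 : Matrix (Fin n) (Fin n) (VecPoly F n n) :=
  Matrix.of fun a i => X (i, a)

/-- `ℓ_0 = det L_0`. -/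
def ell0 : VecPoly F n n := (matL0 F n).det

variable [Fintype F]

/-- `ℓ_{ij}`: the determinant of the matrix obtained from `L_0` by replacing its `j`-th column
by the `q`-th power `X_i^q` of the `i`-th column, where `q = |F|`. -/
def ellij (i j : Fin n) : VecPoly F n n :=
  ((matL0 F n).updateCol j fun a => X (i, a) ^ Fintype.card F).det

/-- `d_{nn}^{(i)} = det (X_i, X_i^q, …, X_i^{q^{n-1}})`. -/
def dnn (i : Fin n) : VecPoly F n n :=
  (Matrix.of fun a k : Fin n => (X (i, a) : VecPoly F n n) ^ Fintype.card F ^ (k : ℕ)).det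

/-- `ℓ = ℓ_0^{r(q-1)-n} ∏_i d_{nn}^{(i)}`, used only when `r(q-1) ≥ n`. -/
def ellLoc (r : ℕ) : VecPoly F n n :=
  ell0 F n ^ (r * (Fintype.card F - 1) - n) * ∏ i : Fin n, dnn F n i

/-- The rational function `ℓ_{ij} / ℓ_0`, with `p = (i, j)`. -/
def ellRatio (p : Fin n × Fin n) : VecField F n n :=
  algebraMap (VecPoly F n n) (VecField F n n) (ellij F n p.1 p.2) /
    algebraMap (VecPoly F n n) (VecField F n n) (ell0 F n)

/-- The subalgebra `F[ℓ_{ij} / ℓ_0 | 1 ≤ i, j ≤ n]` of `F(nW)`. -/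
def ellAlgebra : Subalgebra F (VecField F n n) :=
  Algebra.adjoin F (Set.range (ellRatio F n))

end Steinberg

/-- `A[f⁻¹]`: the subalgebra generated by a subalgebra `A` of a field and the inverse of `f`.
For nonzero `f` in `A` it is the localization of `A` at the powers of `f`. -/
def adjoinInv {F K : Type*} [Field F] [Field K] [Algebra F K] (A : Subalgebra F K) (f : K) :
    Subalgebra F K :=
  A ⊔ Algebra.adjoin F {f⁻¹}

end

/-! ### Semi-invariant determinants. -/

section MixedDet

/-! Let `L` be the matrix with columns `X_i` and `R = L⁻¹ L^(q)`, where `(q)` raises entries to the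
`q`-th power. By Cramer's rule the entries of `R` are the `ℓ_ij/ℓ_0`; let `A` be the algebra they
generate. Everything follows from `L R = L^(q)`.

Differentiating gives `dL · R = 0`, so `F(nW)` is separable algebraic over `Frac A`. Counting
transcendence degree, the `n²` generators are independent, so `A` is a polynomial ring and
integrally closed.

An embedding of `F(nW)` fixing `R` sends `L` to `N L` with `N^(q) = N`, so `N` lies in `GL_n(F)`. By
separability, invariants therefore lie in `Frac A`.

Iterating Frobenius, each `X_i^{q^k}` is an `A`-combination of the columns of `L`. Hence
`d_nn^(i)/ℓ_0` and `ℓ` lie in `A`, and each variable is a root of a `q`-polynomial over `A` with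
leading coefficient `d_nn^(i)/ℓ_0`. So for invariant `f` some `ℓ^m f` is integral over `A` and in
`Frac A`, hence in `A`. Conversely `ℓ · ℓ_ij/ℓ_0` is a product of `r(q-1)` determinants, each scaled
by the same `det`, hence invariant. -/

theorem det_toMatrix_generalLinear_ne_zero {F : Type*} [Field F] {n : ℕ} {W : Type*}
    [AddCommGroup W] [Module F W] (b : Module.Basis (Fin n) F W)
    (σ : LinearMap.GeneralLinearGroup F W) :
    (LinearMap.toMatrix b b (σ : W →ₗ[F] W)).det ≠ 0 := by
  have h : LinearMap.toMatrix b b (σ : W →ₗ[F] W) *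
      LinearMap.toMatrix b b ((σ⁻¹ : LinearMap.GeneralLinearGroup F W) : W →ₗ[F] W) = 1 := by
    rw [← LinearMap.toMatrix_mul, Units.mul_inv, LinearMap.toMatrix_one]
  exact (Matrix.isUnit_det_of_right_inverse h).ne_zero

variable {F : Type*} [Field F] [Fintype F] {n : ℕ}

/-- The determinant with columns `X_{i k}^{q^{e k}}`, which covers `ℓ_0`, `ℓ_{ij}` and
`d_{nn}^{(i)}`. -/
noncomputable def mixedDet (F : Type*) [Field F] [Fintype F] {n : ℕ} (i : Fin n → Fin n)
    (e : Fin n → ℕ) : VecPoly F n n :=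
  (Matrix.of fun a k => (X (i k, a) : VecPoly F n n) ^ Fintype.card F ^ e k).det

theorem ell0_eq_mixedDet : ell0 F n = mixedDet F id 0 := by
  simp [ell0, mixedDet, matL0]

theorem ellij_eq_mixedDet (i j : Fin n) :
    ellij F n i j = mixedDet F (fun k => if k = j then i else k) (fun k => if k = j then 1 else 0) := by
  unfold ellij mixedDet
  congr 1
  ext1 a k
  by_cases h : k = j
  · subst h; simp
  · simp [h, matL0]

theorem dnn_eq_mixedDet (i : Fin n) : dnn F n i = mixedDet F (fun _ => i) (fun k => k) := rfl

theorem pow_card_pow_eq_iterate (R : Type*) [CommRing R] [Algebra F R] (e : ℕ) (x : R) :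
    x ^ Fintype.card F ^ e = (FiniteField.frobeniusAlgHom F R ^ e) x := by
  rw [AlgHom.coe_pow, FiniteField.coe_frobeniusAlgHom, pow_iterate]

variable {W : Type*} [AddCommGroup W] [Module F W]

/-- Frobenius is additive and fixes the matrix entries, which lie in `F`, so every `X_i^{q^e}`
transforms by the same matrix as `X_i`. -/
theorem glAct_X_pow (b : Module.Basis (Fin n) F W) (σ : LinearMap.GeneralLinearGroup F W)
    (i a : Fin n) (e : ℕ) :
    glAct b n σ (X (i, a) ^ Fintype.card F ^ e) = ∑ k, C (LinearMap.toMatrix b b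
      ((σ⁻¹ : LinearMap.GeneralLinearGroup F W) : W →ₗ[F] W) a k) *
        X (i, k) ^ Fintype.card F ^ e := by
  rw [map_pow, glAct, aeval_X, pow_card_pow_eq_iterate, map_sum]
  refine Finset.sum_congr rfl fun k _ => ?_
  rw [map_mul, ← MvPolynomial.algebraMap_eq, AlgHom.commutes, ← pow_card_pow_eq_iterate]

theorem glAct_mixedDet (b : Module.Basis (Fin n) F W) (σ : LinearMap.GeneralLinearGroup F W)
    (i : Fin n → Fin n) (e : Fin n → ℕ) :
    glAct b n σ (mixedDet F i e) = C (LinearMap.toMatrix b b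
      ((σ⁻¹ : LinearMap.GeneralLinearGroup F W) : W →ₗ[F] W)).det * mixedDet F i e := by
  rw [mixedDet, AlgHom.map_det, RingHom.map_det, ← Matrix.det_mul]
  congr 1
  ext1 a k
  simp only [AlgHom.mapMatrix_apply, Matrix.map_apply, Matrix.of_apply, glAct_X_pow,
    Matrix.mul_apply, RingHom.mapMatrix_apply]

/-- A product of `s (q - 1)` mixed determinants is invariant. -/
theorem prod_mixedDet_mem_glInvariants (b : Module.Basis (Fin n) F W) {ι : Type*} (t : Finset ι)
    (i : ι → Fin n → Fin n) (e : ι → Fin n → ℕ) (m : ι → ℕ) (s : ℕ)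
    (h : ∑ k ∈ t, m k = s * (Fintype.card F - 1)) :
    ∏ k ∈ t, mixedDet F (i k) (e k) ^ m k ∈ glInvariants b n := by
  rw [mem_glInvariants]
  intro σ
  simp only [map_prod, map_pow, glAct_mixedDet, mul_pow, Finset.prod_mul_distrib]
  rw [Finset.prod_pow_eq_pow_sum, h, ← map_pow, mul_comm s, pow_mul,
    FiniteField.pow_card_sub_one_eq_one _ (det_toMatrix_generalLinear_ne_zero b _)]
  simp

theorem ell0_ne_zero (F : Type*) [Field F] (n : ℕ) : ell0 F n ≠ 0 := by
  intro h
  have := congrArg (aeval (R := F) (fun p : Fin n × Fin n => if p.1 = p.2 then (1 : F) else 0)) h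
  rw [ell0, AlgHom.map_det, map_zero] at this
  have h1 : (aeval (R := F) (fun p : Fin n × Fin n => if p.1 = p.2 then (1 : F) else 0)).mapMatrix
      (matL0 F n) = 1 := by
    ext1 a k
    simp [matL0, Matrix.one_apply, eq_comm]
  rw [h1, Matrix.det_one] at this
  exact one_ne_zero this

theorem dnn_ne_zero (F : Type*) [Field F] [Fintype F] {n : ℕ} (i : Fin n) : dnn F n i ≠ 0 := by
  intro h
  -- Specializing `x_{ia}` to `t^a` gives a transposed Vandermonde matrix with distinct nodes
  -- `t^{q^k}`.
  have := congrArg (aeval (R := F)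
    (fun p : Fin n × Fin n => (Polynomial.X : Polynomial F) ^ (p.2 : ℕ))) h
  rw [dnn, AlgHom.map_det, map_zero, ← Matrix.det_transpose] at this
  have h1 : ((aeval (R := F)
      (fun p : Fin n × Fin n => (Polynomial.X : Polynomial F) ^ (p.2 : ℕ))).mapMatrix
        (Matrix.of fun a k : Fin n => (X (i, a) : VecPoly F n n) ^ Fintype.card F ^ (k : ℕ))).transpose
      = Matrix.vandermonde fun k : Fin n =>
        (Polynomial.X : Polynomial F) ^ Fintype.card F ^ (k : ℕ) := by
    ext1 k a
    simp [Matrix.vandermonde_apply, ← pow_mul, mul_comm]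
  rw [h1] at this
  refine Matrix.det_vandermonde_ne_zero_iff.2 (fun k l hkl => ?_) this
  have := congrArg Polynomial.natDegree hkl
  simp only [Polynomial.natDegree_X_pow] at this
  exact Fin.ext (Nat.pow_right_injective Fintype.one_lt_card this)

theorem ellLoc_ne_zero (F : Type*) [Field F] [Fintype F] (n r : ℕ) : ellLoc F n r ≠ 0 :=
  mul_ne_zero (pow_ne_zero _ (ell0_ne_zero F n)) (Finset.prod_ne_zero_iff.2 fun i _ => dnn_ne_zero F i)

theorem ellLoc_mem_glInvariants (b : Module.Basis (Fin n) F W) {r : ℕ}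
    (hr : n < r * (Fintype.card F - 1)) : ellLoc F n r ∈ glInvariants b n := by
  have := prod_mixedDet_mem_glInvariants b Finset.univ
    (fun k : Option (Fin n) => k.elim id fun i _ => i)
    (fun k => k.elim 0 fun _ l => l)
    (fun k => k.elim (r * (Fintype.card F - 1) - n) fun _ => 1) r
    (by simp; omega)
  simpa [ellLoc, ell0_eq_mixedDet, dnn_eq_mixedDet] using this

/-- This is `ℓ · ℓ_ij/ℓ_0`: trading one factor `ℓ_0` for `ℓ_ij` keeps the number of determinants at
`r(q-1)`. The strict inequality leaves a factor to trade. -/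
theorem ellij_mul_mem_glInvariants (b : Module.Basis (Fin n) F W) {r : ℕ}
    (hr : n < r * (Fintype.card F - 1)) (i j : Fin n) :
    ellij F n i j * (ell0 F n ^ (r * (Fintype.card F - 1) - n - 1) * ∏ i, dnn F n i) ∈
      glInvariants b n := by
  have := prod_mixedDet_mem_glInvariants b Finset.univ
    (fun k : Option (Option (Fin n)) => k.elim (fun k => if k = j then i else k)
      fun k => k.elim id fun i _ => i)
    (fun k => k.elim (fun k => if k = j then 1 else 0) fun k => k.elim 0 fun _ l => l)
    (fun k => k.elim 1 fun k => k.elim (r * (Fintype.card F - 1) - n - 1) fun _ => 1) r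
    (by simp; omega)
  simpa [ellij_eq_mixedDet, ell0_eq_mixedDet, dnn_eq_mixedDet] using this

end MixedDet

/-! ### The relation `L R = L^(q)` and integrality over `A`. -/

section RatioMatrix

variable (F : Type*) [Field F] (n : ℕ)

/-- The matrix `L_0` over `F(nW)`. -/
noncomputable def genMat : Matrix (Fin n) (Fin n) (VecField F n n) :=
  (matL0 F n).map (algebraMap (VecPoly F n n) (VecField F n n))

variable {F n} in
theorem genMat_apply (a i : Fin n) :
    genMat F n a i = algebraMap (VecPoly F n n) (VecField F n n) (X (i, a)) := rfl

theorem det_genMat : (genMat F n).det = algebraMap (VecPoly F n n) (VecField F n n) (ell0 F n) :=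
  (RingHom.map_det _ _).symm

theorem det_genMat_ne_zero : (genMat F n).det ≠ 0 := by
  rw [det_genMat]
  exact (map_ne_zero_iff _ (IsFractionRing.injective _ _)).2 (ell0_ne_zero F n)

variable [Fintype F]

/-- The matrix `L_0⁻¹ L_1`, whose entry in row `j` and column `i` is `ℓ_{ij} / ℓ_0`. -/
noncomputable def ratioMat : Matrix (Fin n) (Fin n) (ellAlgebra F n) :=
  Matrix.of fun j i => ⟨ellRatio F n (i, j), Algebra.subset_adjoin ⟨_, rfl⟩⟩

variable {F n}

theorem genMat_mulVec_ratioMat (i : Fin n) :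
    (genMat F n).mulVec (fun j => ellRatio F n (i, j)) =
      fun a => genMat F n a i ^ Fintype.card F := by
  have h := Matrix.mulVec_cramer (matL0 F n) fun a => X (i, a) ^ Fintype.card F
  funext a
  have ha := congrArg (algebraMap (VecPoly F n n) (VecField F n n)) (congrFun h a)
  have h0 := det_genMat_ne_zero F n
  rw [det_genMat] at h0
  simp only [Matrix.mulVec, dotProduct, map_sum, map_mul, Matrix.cramer_apply, Pi.smul_apply,
    smul_eq_mul, map_pow] at ha
  simp only [Matrix.mulVec, dotProduct, genMat, Matrix.map_apply, ellRatio, ellij]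
  simp only [mul_div_assoc', ← Finset.sum_div]
  rw [div_eq_iff h0, ha]
  simp [matL0, ell0, mul_comm]

theorem genMat_mul_ratioMat :
    genMat F n * (ratioMat F n).map (algebraMap (ellAlgebra F n) (VecField F n n)) =
      (genMat F n).map (FiniteField.frobeniusAlgHom F (VecField F n n)) := by
  ext1 a i
  exact congrFun (genMat_mulVec_ratioMat i) a

/-- The coordinates of `X_i^{q^k}` with respect to `X_1, …, X_n`. -/
noncomputable def frobCoord (i : Fin n) : ℕ → Fin n → ellAlgebra F n
  | 0 => Pi.single i 1
  | k + 1 => (ratioMat F n).mulVec fun j => frobCoord i k j ^ Fintype.card F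

/-- If `L c = X_i^{q^k}`, Frobenius gives `L^(q) c^(q) = L (R c^(q))`, which is the recursion
defining the coordinates. -/
theorem genMat_mulVec_frobCoord (i : Fin n) (k : ℕ) :
    (genMat F n).mulVec (fun j => algebraMap (ellAlgebra F n) (VecField F n n) (frobCoord i k j)) =
      fun a => genMat F n a i ^ Fintype.card F ^ k := by
  induction k with
  | zero =>
    funext a
    simp [frobCoord, Matrix.mulVec, dotProduct, Pi.single_apply]
  | succ k ih =>
    have h : (fun j => algebraMap (ellAlgebra F n) (VecField F n n) (frobCoord i (k + 1) j)) =
        ((ratioMat F n).map (algebraMap (ellAlgebra F n) (VecField F n n))).mulVec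
          (FiniteField.frobeniusAlgHom F (VecField F n n) ∘
            fun j => algebraMap (ellAlgebra F n) (VecField F n n) (frobCoord i k j)) := by
      funext j
      simp [frobCoord, Matrix.mulVec, dotProduct]
    rw [h, Matrix.mulVec_mulVec, genMat_mul_ratioMat]
    funext a
    have := (RingHom.map_mulVec (FiniteField.frobeniusAlgHom F (VecField F n n)).toRingHom
      (genMat F n) (fun j => algebraMap (ellAlgebra F n) (VecField F n n) (frobCoord i k j)) a).symm
    refine Eq.trans this ?_
    rw [ih]
    simp [pow_succ, pow_mul]

/-- The determinant `d_{nn}^{(i)} / ℓ_0`, as an element of `F[ℓ_{ij} / ℓ_0]`. -/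
noncomputable def dnnRatio (i : Fin n) : ellAlgebra F n :=
  (Matrix.of fun j k : Fin n => frobCoord i k j).det

theorem ell0_mul_dnnRatio (i : Fin n) :
    (genMat F n).det * algebraMap (ellAlgebra F n) (VecField F n n) (dnnRatio i) =
      algebraMap (VecPoly F n n) (VecField F n n) (dnn F n i) := by
  rw [dnnRatio, RingHom.map_det, ← Matrix.det_mul, dnn, RingHom.map_det]
  congr 1
  ext1 a k
  have := congrFun (genMat_mulVec_frobCoord (F := F) i k) a
  simp only [Matrix.mulVec, dotProduct] at this
  simp only [Matrix.mul_apply, RingHom.mapMatrix_apply, Matrix.map_apply, Matrix.of_apply, this]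
  simp [genMat, matL0]

theorem dnnRatio_ne_zero (i : Fin n) : (dnnRatio i : ellAlgebra F n) ≠ 0 := by
  intro h
  have := ell0_mul_dnnRatio (F := F) i
  rw [h, map_zero, mul_zero] at this
  exact dnn_ne_zero F i ((map_eq_zero_iff _ (IsFractionRing.injective _ _)).1 this.symm)

theorem det_ratioMat : algebraMap (ellAlgebra F n) (VecField F n n) (ratioMat F n).det =
    (genMat F n).det ^ (Fintype.card F - 1) := by
  have h := congrArg Matrix.det (genMat_mul_ratioMat (F := F) (n := n))
  have h2 := (AlgHom.map_det (FiniteField.frobeniusAlgHom F (VecField F n n)) (genMat F n)).symm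
  rw [AlgHom.mapMatrix_apply] at h2
  rw [Matrix.det_mul, h2, FiniteField.frobeniusAlgHom_apply] at h
  have h3 := (RingHom.map_det (algebraMap (ellAlgebra F n) (VecField F n n)) (ratioMat F n))
  rw [RingHom.mapMatrix_apply] at h3
  rw [h3]
  apply mul_left_cancel₀ (det_genMat_ne_zero F n)
  rw [h, ← pow_succ', Nat.sub_add_cancel Fintype.card_pos]

/-- The element `ℓ` of `F[ℓ_{ij} / ℓ_0]`. -/
noncomputable def ellLocRatio (r : ℕ) : ellAlgebra F n := (ratioMat F n).det ^ r * ∏ i, dnnRatio i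

/-- Since `det R = ℓ_0^{q-1}`, the `n` denominators `ℓ_0` of the `d_nn^(i)/ℓ_0` account for the `-n`
in the exponent of `ℓ`. -/
theorem algebraMap_ellLocRatio {r : ℕ} (hr : n < r * (Fintype.card F - 1)) :
    algebraMap (ellAlgebra F n) (VecField F n n) (ellLocRatio r) =
      algebraMap (VecPoly F n n) (VecField F n n) (ellLoc F n r) := by
  simp only [ellLocRatio, ellLoc, map_mul, map_pow, map_prod, ← ell0_mul_dnnRatio, det_ratioMat,
    ← det_genMat, Finset.prod_mul_distrib]
  rw [← mul_assoc, Finset.prod_const, Finset.card_univ, Fintype.card_fin, ← pow_add, ← pow_mul,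
    Nat.sub_add_cancel hr.le, mul_comm r]

/-- Cramer's rule expresses the coordinates of `X_i^{q^n}` through those of `X_i^{q^k}`, `k < n`. -/
theorem dnnRatio_mul_pow_eq (i a : Fin n) : ∃ c : Fin n → ellAlgebra F n,
    algebraMap (ellAlgebra F n) (VecField F n n) (dnnRatio i) *
        genMat F n a i ^ Fintype.card F ^ n =
      ∑ k : Fin n, algebraMap (ellAlgebra F n) (VecField F n n) (c k) *
        genMat F n a i ^ Fintype.card F ^ (k : ℕ) := by
  refine ⟨Matrix.cramer (Matrix.of fun j k : Fin n => frobCoord i k j) (frobCoord i n), ?_⟩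
  have h := Matrix.mulVec_cramer (Matrix.of fun j k : Fin n => frobCoord (F := F) i k j)
    (frobCoord i n)
  have e := fun k => congrFun (genMat_mulVec_frobCoord (F := F) i k) a
  simp only [← e]
  simp only [Matrix.mulVec, dotProduct, Finset.mul_sum]
  rw [Finset.sum_comm]
  refine Finset.sum_congr rfl fun j _ => ?_
  have hj := congrArg (algebraMap (ellAlgebra F n) (VecField F n n)) (congrFun h j)
  simp only [Matrix.mulVec, dotProduct, map_sum, map_mul, Pi.smul_apply, smul_eq_mul,
    Matrix.of_apply] at hj
  rw [mul_left_comm, dnnRatio, ← hj, Finset.mul_sum]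
  exact Finset.sum_congr rfl fun k _ => by ring

/-- A root times the leading coefficient of its polynomial is integral. -/
theorem isIntegral_dnnRatio_mul (i a : Fin n) :
    IsIntegral (ellAlgebra F n) ((dnnRatio i : ellAlgebra F n) • genMat F n a i) := by
  obtain ⟨c, hc⟩ := dnnRatio_mul_pow_eq (F := F) i a
  set q := Fintype.card F
  set p : Polynomial (ellAlgebra F n) :=
    -∑ k : Fin n, Polynomial.C (c k) * Polynomial.X ^ q ^ (k : ℕ) with hp
  have hdeg : p.degree < (Polynomial.C (dnnRatio i : ellAlgebra F n) * Polynomial.X ^ q ^ n).degree := by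
    rw [Polynomial.degree_C_mul_X_pow _ (dnnRatio_ne_zero (F := F) i), hp, Polynomial.degree_neg]
    refine (Polynomial.degree_sum_le _ _).trans_lt ((Finset.sup_lt_iff (WithBot.bot_lt_coe _)).2 ?_)
    intro k _
    refine (Polynomial.degree_C_mul_X_pow_le _ _).trans_lt ?_
    exact_mod_cast (Nat.pow_lt_pow_right (Fintype.one_lt_card (α := F)) k.2 : q ^ (k : ℕ) < q ^ n)
  have := isIntegral_leadingCoeff_smul (p + Polynomial.C (dnnRatio i : ellAlgebra F n) * Polynomial.X ^ q ^ n)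
    (genMat F n a i) (by
      simp only [hp, map_add, map_neg, map_sum, map_mul, map_pow, Polynomial.aeval_C,
        Polynomial.aeval_X, hc, neg_add_cancel])
  rwa [Polynomial.leadingCoeff_add_of_degree_lt hdeg, Polynomial.leadingCoeff_C_mul_X_pow] at this

theorem isIntegral_ellLocRatio_mul (r : ℕ) (p : Fin n × Fin n) :
    IsIntegral (ellAlgebra F n) (algebraMap (ellAlgebra F n) (VecField F n n) (ellLocRatio r) *
      algebraMap (VecPoly F n n) (VecField F n n) (X p)) := by
  have h := isIntegral_dnnRatio_mul (F := F) p.1 p.2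
  rw [Algebra.smul_def] at h
  have e : ellLocRatio (F := F) (n := n) r = ((ratioMat F n).det ^ r *
      ∏ i ∈ Finset.univ.erase p.1, dnnRatio i) * dnnRatio p.1 := by
    rw [ellLocRatio, ← Finset.prod_erase_mul _ _ (Finset.mem_univ p.1), mul_assoc]
  rw [e, map_mul, mul_assoc]
  exact isIntegral_algebraMap.mul h

theorem exists_isIntegral_ellLocRatio_pow_mul (r : ℕ) (f : VecPoly F n n) :
    ∃ m : ℕ, IsIntegral (ellAlgebra F n)
      (algebraMap (ellAlgebra F n) (VecField F n n) (ellLocRatio r) ^ m *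
        algebraMap (VecPoly F n n) (VecField F n n) f) := by
  induction f using MvPolynomial.induction_on with
  | C a =>
    refine ⟨0, ?_⟩
    have : algebraMap (VecPoly F n n) (VecField F n n) (C a) =
        algebraMap (ellAlgebra F n) (VecField F n n) (algebraMap F _ a) := by
      rw [← MvPolynomial.algebraMap_eq, ← IsScalarTower.algebraMap_apply,
        ← IsScalarTower.algebraMap_apply]
    rw [pow_zero, one_mul, this]
    exact isIntegral_algebraMap
  | add f g hf hg =>
    obtain ⟨k, hk⟩ := hf
    obtain ⟨l, hl⟩ := hg
    refine ⟨k + l, ?_⟩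
    have := ((isIntegral_algebraMap (x := ellLocRatio r)).pow l |>.mul hk).add
      ((isIntegral_algebraMap (x := ellLocRatio r)).pow k |>.mul hl)
    refine (congrArg (IsIntegral (ellAlgebra F n)) ?_).mp this
    rw [map_add]
    ring
  | mul_X f p hf =>
    obtain ⟨k, hk⟩ := hf
    refine ⟨k + 1, ?_⟩
    refine (congrArg (IsIntegral (ellAlgebra F n)) ?_).mp (hk.mul (isIntegral_ellLocRatio_mul r p))
    rw [map_mul]
    ring

end RatioMatrix

/-! ### Separability, algebraic independence, integral closedness. -/

section RatioField

variable (F : Type*) [Field F] [Fintype F] (n : ℕ)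

/-- The field `F(ℓ_{ij} / ℓ_0 | 1 ≤ i, j ≤ n)`. -/
noncomputable abbrev ellField : IntermediateField F (VecField F n n) :=
  IntermediateField.adjoin F (Set.range (ellRatio F n))

variable {F n}

theorem ellRatio_mem_ellField (p : Fin n × Fin n) : ellRatio F n p ∈ ellField F n :=
  IntermediateField.subset_adjoin _ _ ⟨p, rfl⟩

theorem genMat_pow_card (a i : Fin n) :
    genMat F n a i ^ Fintype.card F = ∑ j, genMat F n a j * ellRatio F n (i, j) :=
  (congrFun (genMat_mulVec_ratioMat i) a).symm

theorem isUnit_ratioMat : IsUnit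
    ((ratioMat F n).map (algebraMap (ellAlgebra F n) (VecField F n n))) := by
  rw [Matrix.isUnit_iff_isUnit_det, isUnit_iff_ne_zero]
  have h := RingHom.map_det (algebraMap (ellAlgebra F n) (VecField F n n)) (ratioMat F n)
  rw [RingHom.mapMatrix_apply] at h
  rw [← h, det_ratioMat]
  exact pow_ne_zero _ (det_genMat_ne_zero F n)

/-- `D` kills `q`-th powers and the entries of `R`, so `L^(q) = L R` gives `D(L) R = 0`, and `R` is
invertible. -/
theorem derivation_algebraMap_X_eq_zero {M : Type*} [AddCommGroup M] [Module (VecField F n n) M]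
    [Module (ellField F n) M]
    (D : Derivation (ellField F n) (VecField F n n) M) (p : Fin n × Fin n) :
    D (algebraMap (VecPoly F n n) (VecField F n n) (X p)) = 0 := by
  obtain ⟨i, a⟩ := p
  obtain ⟨S, hS⟩ := (isUnit_ratioMat (F := F) (n := n)).exists_right_inv
  have hq : ((Fintype.card F : ℕ) : VecField F n n) = 0 := by
    have := congrArg (algebraMap F (VecField F n n)) (Nat.cast_card_eq_zero F)
    rwa [map_natCast, map_zero] at this
  have key : ∀ k, ∑ j, ellRatio F n (k, j) • D (genMat F n a j) = 0 := by
    intro k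
    have h := congrArg D (genMat_pow_card (F := F) a k)
    rw [Derivation.leibniz_pow, ← Nat.cast_smul_eq_nsmul (VecField F n n), hq, zero_smul,
      map_sum] at h
    rw [h]
    refine Finset.sum_congr rfl fun j _ => ?_
    have h0 : D (ellRatio F n (k, j)) = 0 :=
      D.map_algebraMap (⟨ellRatio F n (k, j), ellRatio_mem_ellField _⟩ : ellField F n)
    rw [Derivation.leibniz, h0, smul_zero, zero_add]
  rw [← genMat_apply]
  calc D (genMat F n a i)
      = ∑ j, (1 : Matrix (Fin n) (Fin n) (VecField F n n)) j i • D (genMat F n a j) := by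
        simp [Matrix.one_apply]
    _ = ∑ k, S k i • ∑ j, ellRatio F n (k, j) • D (genMat F n a j) := by
        simp only [← hS, Matrix.mul_apply, Finset.sum_smul, Finset.smul_sum]
        rw [Finset.sum_comm]
        refine Finset.sum_congr rfl fun k _ => Finset.sum_congr rfl fun j _ => ?_
        rw [mul_comm, mul_smul]
        rfl
    _ = 0 := by simp [key]

theorem derivation_eq_zero {M : Type*} [AddCommGroup M] [Module (VecField F n n) M]
    [Module (ellField F n) M]
    (D : Derivation (ellField F n) (VecField F n n) M) (x : VecField F n n) : D x = 0 := by
  have hp : ∀ f : VecPoly F n n, D (algebraMap (VecPoly F n n) (VecField F n n) f) = 0 := by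
    intro f
    induction f using MvPolynomial.induction_on with
    | C a =>
      have : algebraMap (VecPoly F n n) (VecField F n n) (C a) =
          algebraMap (ellField F n) (VecField F n n) (algebraMap F _ a) := by
        rw [← MvPolynomial.algebraMap_eq, ← IsScalarTower.algebraMap_apply,
          ← IsScalarTower.algebraMap_apply]
      rw [this, D.map_algebraMap]
    | add f g hf hg => rw [map_add, map_add, hf, hg, add_zero]
    | mul_X f p hf =>
      rw [map_mul, Derivation.leibniz, hf, derivation_algebraMap_X_eq_zero, smul_zero, smul_zero,
        add_zero]
  obtain ⟨f, g, -, rfl⟩ := IsFractionRing.div_surjective (A := VecPoly F n n) x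
  rw [Derivation.leibniz_div, hp, hp, smul_zero, smul_zero, sub_zero, smul_zero]

instance formallyUnramified_ellField :
    Algebra.FormallyUnramified (ellField F n) (VecField F n n) := by
  refine ⟨?_⟩
  rw [← Submodule.subsingleton_iff (VecField F n n)]
  refine subsingleton_of_bot_eq_top ?_
  rw [← KaehlerDifferential.span_range_derivation, eq_comm, Submodule.span_eq_bot]
  rintro _ ⟨x, rfl⟩
  exact derivation_eq_zero _ x

instance isSeparable_ellField : Algebra.IsSeparable (ellField F n) (VecField F n n) := by
  have : Algebra.EssFiniteType F (VecField F n n) := Algebra.EssFiniteType.comp F (VecPoly F n n) _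
  have := Algebra.EssFiniteType.of_comp F (ellField F n) (VecField F n n)
  exact Algebra.FormallyUnramified.isSeparable _ _

open IntermediateField.algebraAdjoinAdjoin in
-- `F(nW)` has transcendence degree at least `n²` and is algebraic over the algebra generated by
-- these `n²` elements.
theorem algebraicIndependent_ellRatio : AlgebraicIndependent F (ellRatio F n) := by
  have : Algebra.IsAlgebraic (Algebra.adjoin F (Set.range (ellRatio F n))) (VecField F n n) :=
    Algebra.IsAlgebraic.trans _ (ellField F n) _
  refine (Algebra.IsAlgebraic.isTranscendenceBasis_of_lift_le_trdeg_of_finite F (ellRatio F n) ?_).1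
  have h := (MvPolynomial.algebraicIndependent_X (Fin n × Fin n) F).map'
    (f := IsScalarTower.toAlgHom F (VecPoly F n n) (VecField F n n))
    (IsFractionRing.injective _ _)
  exact h.lift_cardinalMk_le_trdeg

theorem isIntegrallyClosed_ellAlgebra : IsIntegrallyClosed (ellAlgebra F n) :=
  IsIntegrallyClosed.of_equiv
    (algebraicIndependent_ellRatio (F := F) (n := n)).aevalEquiv.toRingEquiv

open IntermediateField.algebraAdjoinAdjoin in
theorem mem_ellAlgebra_of_isIntegral {x : VecField F n n} (hx : x ∈ ellField F n)
    (hi : IsIntegral (ellAlgebra F n) x) : x ∈ ellAlgebra F n := by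
  have : IsIntegrallyClosed (Algebra.adjoin F (Set.range (ellRatio F n))) :=
    isIntegrallyClosed_ellAlgebra
  have hi' : IsIntegral (Algebra.adjoin F (Set.range (ellRatio F n))) x := hi
  have hy : IsIntegral (Algebra.adjoin F (Set.range (ellRatio F n))) (⟨x, hx⟩ : ellField F n) :=
    (isIntegral_algebraMap_iff (algebraMap (ellField F n) (VecField F n n)).injective).1 hi'
  obtain ⟨z, hz⟩ := IsIntegrallyClosed.algebraMap_eq_of_integral hy
  have := congrArg (algebraMap (ellField F n) (VecField F n n)) hz
  exact (show z.1 = x from this) ▸ z.2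

end RatioField

/-! ### Descent to a base field. -/

section Separable

/-- A separable element on which all embeddings into an algebraically closed field agree with a
given one lies in the base field. -/
theorem mem_range_algebraMap_of_forall_algHom {K L Ω : Type*} [Field K] [Field L] [Field Ω]
    [Algebra K L] [Algebra K Ω] [IsAlgClosed Ω] [Algebra.IsSeparable K L] (x : L) (y : Ω)
    (h : ∀ φ : L →ₐ[K] Ω, φ x = y) : x ∈ (algebraMap K L).range := by
  rw [← minpoly.natDegree_eq_one_iff]
  have hr := Algebra.IsAlgebraic.range_eval_eq_rootSet_minpoly (F := K) Ω x
  have hs := Polynomial.card_rootSet_eq_natDegree (K := Ω) (Algebra.IsSeparable.isSeparable K x)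
    (IsAlgClosed.splits _)
  refine le_antisymm ?_ (minpoly.natDegree_pos (Algebra.IsIntegral.isIntegral x))
  -- By separability the degree of the minimal polynomial counts its roots, which are the values `φ
  -- x`.
  rw [← hs, Fintype.card_le_one_iff_subsingleton]
  refine Set.subsingleton_coe _ |>.2 (Set.subsingleton_of_subset_singleton (a := y) ?_)
  rw [← hr]
  rintro _ ⟨φ, rfl⟩
  exact h φ

theorem FiniteField.mem_range_algebraMap_of_pow_card_eq {F R : Type*} [Field F] [Fintype F] [Field R]
    [Algebra F R] {x : R} (hx : x ^ Fintype.card F = x) : x ∈ (algebraMap F R).range := by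
  have h1 : Polynomial.Splits (Polynomial.X ^ Fintype.card F - Polynomial.X : Polynomial F) := by
    rw [Polynomial.splits_iff_card_roots, FiniteField.roots_X_pow_card_sub_X,
      FiniteField.X_pow_card_sub_X_natDegree_eq F Fintype.one_lt_card]
    rfl
  have h2 : Polynomial.aeval x (Polynomial.X ^ Fintype.card F - Polynomial.X : Polynomial F) = 0 := by
    simp [hx]
  exact h1.mem_range_of_isRoot (FiniteField.X_pow_card_sub_X_ne_zero F Fintype.one_lt_card)
    (by rwa [Polynomial.IsRoot.def, Polynomial.eval_map_algebraMap])

end Separable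

/-! ### Embeddings over `Frac A` and the invariants. -/

section Invariants

theorem exists_generalLinear_toMatrix_eq {F : Type*} [Field F] {n : ℕ} {W : Type*}
    [AddCommGroup W] [Module F W] (b : Module.Basis (Fin n) F W)
    {M : Matrix (Fin n) (Fin n) F} (hM : IsUnit M) :
    ∃ σ : LinearMap.GeneralLinearGroup F W,
      LinearMap.toMatrix b b ((σ⁻¹ : LinearMap.GeneralLinearGroup F W) : W →ₗ[F] W) = M := by
  obtain ⟨u, rfl⟩ := hM
  refine ⟨((Units.mapEquiv (LinearMap.toMatrixAlgEquiv b).toMulEquiv).symm u)⁻¹, ?_⟩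
  rw [inv_inv]
  exact (LinearMap.toMatrixAlgEquiv b).apply_symm_apply (u : Matrix (Fin n) (Fin n) F)

variable {F : Type*} [Field F] [Fintype F] {n : ℕ} {W : Type*} [AddCommGroup W] [Module F W]

/-- The embeddings of `F(nW)` over `F(ℓ_{ij} / ℓ_0)` come from elements of `GL(W)`. -/
theorem exists_glAct_of_algHom (b : Module.Basis (Fin n) F W) {Ω : Type*} [Field Ω]
    [Algebra F Ω] [Algebra (VecField F n n) Ω] [IsScalarTower F (VecField F n n) Ω]
    (φ : VecField F n n →ₐ[F] Ω)
    (hφ : ∀ p, φ (ellRatio F n p) = algebraMap (VecField F n n) Ω (ellRatio F n p)) :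
    ∃ σ : LinearMap.GeneralLinearGroup F W, ∀ f : VecPoly F n n,
      φ (algebraMap (VecPoly F n n) (VecField F n n) f) =
        algebraMap (VecField F n n) Ω
          (algebraMap (VecPoly F n n) (VecField F n n) (glAct b n σ f)) := by
  set ψ : VecField F n n →ₐ[F] Ω := IsScalarTower.toAlgHom F (VecField F n n) Ω
  set T := (ratioMat F n).map (algebraMap (ellAlgebra F n) (VecField F n n)) with hT
  have hT' : T.map φ = T.map ψ := by
    ext1 j i
    exact hφ (i, j)
  have hmap : ∀ θ : VecField F n n →ₐ[F] Ω, ((genMat F n).map θ).map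
      (FiniteField.frobeniusAlgHom F Ω) = (genMat F n).map θ * T.map θ := by
    intro θ
    have h := congrArg (fun M => M.map θ) (genMat_mul_ratioMat (F := F) (n := n))
    simp only [Matrix.map_mul] at h
    rw [h]
    ext1 a i
    simp [Matrix.map_apply]
  have hdet : ∀ θ : VecField F n n →ₐ[F] Ω, IsUnit ((genMat F n).map θ) := by
    intro θ
    exact ((Matrix.isUnit_iff_isUnit_det _).2
      (isUnit_iff_ne_zero.2 (det_genMat_ne_zero F n))).map θ.mapMatrix
  obtain ⟨S, hS⟩ := (hdet ψ).exists_right_inv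
  set N := (genMat F n).map φ * S with hN
  have hNL : N * (genMat F n).map ψ = (genMat F n).map φ := by
    rw [hN, Matrix.mul_assoc, mul_eq_one_comm.1 hS, Matrix.mul_one]
  -- `φ(L)` and `ψ(L)` both solve `Y^(q) = Y T`, with the same `T`; hence `N^(q) ψ(L) = N ψ(L)`
  -- after cancelling `T`.
  have hfrob : N.map (FiniteField.frobeniusAlgHom F Ω) = N := by
    have h := congrArg (fun M => M.map (FiniteField.frobeniusAlgHom F Ω)) hNL
    simp only [Matrix.map_mul] at h
    rw [hmap, hmap, hT', ← hNL, Matrix.mul_assoc, ← Matrix.mul_assoc, ← Matrix.mul_assoc] at h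
    exact (((isUnit_ratioMat (F := F) (n := n)).map ψ.mapMatrix).mul_left_injective.eq_iff.1 h) |>
      (hdet ψ).mul_left_injective.eq_iff.1
  have hrange : ∀ a k, ∃ c : F, algebraMap F Ω c = N a k := fun a k =>
    FiniteField.mem_range_algebraMap_of_pow_card_eq (congrFun (congrFun hfrob a) k)
  choose M hM using hrange
  have hM' : (algebraMap F Ω).mapMatrix (Matrix.of M) = N := by
    ext1 a k
    exact hM a k
  have hMu : IsUnit (Matrix.of M) := by
    have hNu : IsUnit N := by
      have h := hdet φ
      rw [← hNL] at h
      exact isUnit_of_mul_isUnit_left h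
    rw [Matrix.isUnit_iff_isUnit_det, isUnit_iff_ne_zero] at hNu ⊢
    rw [← hM', ← RingHom.map_det] at hNu
    exact fun h => hNu (by rw [h, map_zero])
  obtain ⟨σ, hσ⟩ := exists_generalLinear_toMatrix_eq b hMu
  refine ⟨σ, fun f => ?_⟩
  set ι := IsScalarTower.toAlgHom F (VecPoly F n n) (VecField F n n)
  have : φ.comp ι = (ψ.comp ι).comp (glAct b n σ) := by
    ext ⟨i, a⟩
    have h := congrFun (congrFun hNL a) i
    simp only [Matrix.mul_apply, Matrix.map_apply, genMat_apply, ← hM] at h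
    simp only [AlgHom.comp_apply, glAct, aeval_X, hσ, map_sum, map_mul, Matrix.of_apply,
      ← MvPolynomial.algebraMap_eq, AlgHom.commutes]
    exact h.symm
  exact DFunLike.congr_fun this f

theorem glInvariants_mem_ellField (b : Module.Basis (Fin n) F W) {f : VecPoly F n n}
    (hf : f ∈ glInvariants b n) :
    algebraMap (VecPoly F n n) (VecField F n n) f ∈ ellField F n := by
  rw [mem_glInvariants] at hf
  have := mem_range_algebraMap_of_forall_algHom (K := ellField F n)
    (algebraMap (VecPoly F n n) (VecField F n n) f)
    (algebraMap (VecField F n n) (AlgebraicClosure (VecField F n n))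
      (algebraMap (VecPoly F n n) (VecField F n n) f)) (by
      intro φ
      obtain ⟨σ, hσ⟩ := exists_glAct_of_algHom b (φ.restrictScalars F) (fun p => by
        have h := φ.commutes ⟨_, ellRatio_mem_ellField p⟩
        rw [IsScalarTower.algebraMap_apply (ellField F n) (VecField F n n)] at h
        exact h)
      exact (hσ f).trans (by rw [hf σ]))
  obtain ⟨y, hy⟩ := this
  exact hy ▸ y.2

end Invariants

theorem proposition3p2 {F : Type*} [Field F] [Fintype F] {W : Type*} [AddCommGroup W] [Module F W]
    (n : ℕ) (hn : 2 ≤ n) (b : Module.Basis (Fin n) F W)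
    (r : ℕ) (hr : IsLeast {s : ℕ | 0 < s ∧ n < s * (Fintype.card F - 1)} r) :
    -- `ℓ` is a nonzero element of both rings, so that both may be localized at it
    ellLoc F n r ≠ 0 ∧
    ellLoc F n r ∈ glInvariants b n ∧
    algebraMap (VecPoly F n n) (VecField F n n) (ellLoc F n r) ∈ ellAlgebra F n ∧
    -- `F[ℓ_{ij} / ℓ_0]` is a polynomial ring
    AlgebraicIndependent F (ellRatio F n) ∧
    -- the two localizations coincide inside `F(nW)`
    adjoinInv ((glInvariants b n).map
        (IsScalarTower.toAlgHom F (VecPoly F n n) (VecField F n n)))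
        (algebraMap (VecPoly F n n) (VecField F n n) (ellLoc F n r)) =
      adjoinInv (ellAlgebra F n)
        (algebraMap (VecPoly F n n) (VecField F n n) (ellLoc F n r)) := by
  have hr' : n < r * (Fintype.card F - 1) := hr.1.2
  have hℓ := algebraMap_ellLocRatio (F := F) hr'
  have hmem : algebraMap (VecPoly F n n) (VecField F n n) (ellLoc F n r) ∈ ellAlgebra F n :=
    hℓ ▸ (ellLocRatio r).2
  have h0 : algebraMap (VecPoly F n n) (VecField F n n) (ellLoc F n r) ≠ 0 :=
    (map_ne_zero_iff _ (IsFractionRing.injective _ _)).2 (ellLoc_ne_zero F n r)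
  refine ⟨ellLoc_ne_zero F n r, ellLoc_mem_glInvariants b hr', hmem,
    algebraicIndependent_ellRatio, le_antisymm (sup_le ?_ le_sup_right) (sup_le ?_ le_sup_right)⟩
  · rintro _ ⟨f, hf, rfl⟩
    obtain ⟨m, hm⟩ := exists_isIntegral_ellLocRatio_pow_mul (F := F) r f
    rw [hℓ] at hm
    have hA := mem_ellAlgebra_of_isIntegral (mul_mem (pow_mem
      (IntermediateField.algebra_adjoin_le_adjoin _ _ hmem) m) (glInvariants_mem_ellField b hf)) hm
    have hinv : (algebraMap (VecPoly F n n) (VecField F n n) (ellLoc F n r))⁻¹ ∈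
        adjoinInv (ellAlgebra F n)
          (algebraMap (VecPoly F n n) (VecField F n n) (ellLoc F n r)) :=
      (le_sup_right : _ ≤ adjoinInv _ _) (Algebra.self_mem_adjoin_singleton F _)
    have := mul_mem (pow_mem hinv m) ((le_sup_left : _ ≤ adjoinInv _ _) hA)
    rwa [inv_pow, inv_mul_cancel_left₀ (pow_ne_zero m h0)] at this
  · rw [ellAlgebra, Algebra.adjoin_le_iff]
    rintro _ ⟨⟨i, j⟩, rfl⟩
    have hinv : (algebraMap (VecPoly F n n) (VecField F n n) (ellLoc F n r))⁻¹ ∈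
        adjoinInv ((glInvariants b n).map
          (IsScalarTower.toAlgHom F (VecPoly F n n) (VecField F n n)))
          (algebraMap (VecPoly F n n) (VecField F n n) (ellLoc F n r)) :=
      (le_sup_right : _ ≤ adjoinInv _ _) (Algebra.self_mem_adjoin_singleton F _)
    have := mul_mem ((le_sup_left : _ ≤ adjoinInv _ _) (Subalgebra.mem_map.2
      ⟨_, ellij_mul_mem_glInvariants b hr' i j, rfl⟩)) hinv
    refine (congrArg (· ∈ _) ?_).mp this
    have hl0 : algebraMap (VecPoly F n n) (VecField F n n) (ell0 F n) ≠ 0 :=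
      (map_ne_zero_iff _ (IsFractionRing.injective _ _)).2 (ell0_ne_zero F n)
    -- It remains to check that `ℓ_ij/ℓ_0` is the invariant `ℓ · ℓ_ij/ℓ_0` divided by `ℓ`.
    rw [← div_eq_mul_inv, ellRatio, div_eq_div_iff h0 hl0]
    simp only [IsScalarTower.coe_toAlgHom', ← map_mul]
    congr 1
    rw [ellLoc, mul_assoc]
    congr 1
    rw [mul_right_comm, ← pow_succ]
    congr 2
    omega
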